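/- **Unconditional stability of partially implicit flux coupling for the bulk interface condition.** Let $\nu_\pm,\rho_\pm,c_\pm,\Delta z_\pm,\Delta t>0$ and $b\ge 0$ be real numbers (heat diffusion coefficients, densities, heat capacities and grid spacings of the atmosphere $(+)$ and the ocean $(-)$, time step, bulk coefficient). Put $$d_\pm=\frac{\nu_\pm\,\Delta t}{\rho_\pm c_\pm(\Delta z_\pm)^2},\qquad \beta_\pm=\frac{b\,\Delta t}{\rho_\pm c_\pm\Delta z_\pm}.$$ Consider complex grid functions $T^n=(T^n_{j+1/2})_{j\in\mathbb Z}$, $n\ge 0$, which solve the coupled backward Euler scheme $$T_{j+\frac12}^{n+1}-T_{j+\frac12}^n=\frac{\Delta t}{\rho_+c_+\Delta z_+}\bigl(q_{j+1}^{n+1}-q_j^{n+1}\bigr)\ (j\ge 0),\qquad T_{j+\frac12}^{n+1}-T_{j+\frac12}^n=\frac{\Delta t}{\rho_-c_-\Delta z_-}\bigl(q_{j+1}^{n+1}-q_j^{n+1}\bigr)\ (j<0),$$ with $q_j^{n+1}=\nu_\pm\,(T_{j+1/2}^{n+1}-T_{j-1/2}^{n+1})/\Delta z_\pm$ for $j>0$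 (sign $+$) and for $j<0$ (sign $-$). At $j=0$ the first equation uses $q_{0_+}^{n+1}=b\,(T_{1/2}^{n+1}-T_{-1/2}^{n})$ and the second one uses $q_{0_-}^{n+1}=b\,(T_{1/2}^{n}-T_{-1/2}^{n+1})$. An *eigensolution* is a solution $T^n_{j+1/2}=\mathcal A^n\varphi_j$ with $\mathcal A\in\mathbb C$, $\varphi\ne 0$ and $\varphi_j\to 0$ as $j\to\pm\infty$. Then, without any restriction on the parameters, the following holds. 1. There is no eigensolution with $|\mathcal A|\ge 1$. 2. If $T^n_{j+1/2}=\mathcal A^n\varphi_j$ is a solution with $\varphi\neq 0$ only bounded and $|\mathcal A|\ge 1$, then $\mathcal A=1$ and $\varphi$ is constant on $\{j\ge 0\}$ and on $\{j<0\}$, with the same constant on both if $b>0$. 3. Let $a_\pm\in\mathbb C\setminus\{0\}$ and $0<|\kappa_+|<1<|\kappa_-|$, and let $T^n_{j+1/2}=\mathcal A^n a_+\kappa_+^{\,j+1}$ $(j\ge 0)$, $T^n_{j+1/2}=\mathcal A^n a_-\kappa_-^{\,j}$ $(j<0)$ be a solution. Put $\theta=\frac{a_-}{a_+}\kappa_-^{-1}\kappa_+^{-1}$,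 so that $\theta^{-1}=\frac{a_+}{a_-}\kappa_-\kappa_+$. Then $$\mathcal A=\frac{1+\beta_+\theta}{\beta_++1-d_+(\kappa_+-1)}=\frac{1+\beta_-\theta^{-1}}{\beta_-+1-d_-(\kappa_-^{-1}-1)},$$ $$|\beta_++1-d_+(\kappa_+-1)|>1+\beta_+,\qquad |\beta_-+1-d_-(\kappa_-^{-1}-1)|>1+\beta_-;$$ if $|\theta|\le 1$, then $|1+\beta_+\theta|\le 1+\beta_+$; if $|\theta^{-1}|\le 1$, then $|1+\beta_-\theta^{-1}|\le 1+\beta_-$. 4. The scheme is stable: every solution with all $T^n$ bounded satisfies $\sup_j|T^n_{j+1/2}|\le\sup_j|T^0_{j+1/2}|$ for all $n$, and there is a constant $C$, depending only on the parameters, such that every solution with all $T^n$ square-summable satisfies $\bigl(\sum_j|T^n_{j+1/2}|^2\bigr)^{1/2}\le C\bigl(\sum_j|T^0_{j+1/2}|^2\bigr)^{1/2}$ for all $n$. -/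

import Mathlib

open Filter Topology
open scoped ENNReal

noncomputable section

/-- Physical and numerical parameters of the coupled model. The suffix `p` marks the atmosphere
(`z > 0`), the suffix `m` the ocean (`z < 0`): heat diffusion coefficients `ν`, densities `ρ`, heat
capacities `c`, grid spacings `Δz`; `Δt` is the time step and `b` the bulk coefficient. -/
structure CouplingParams where
  νp : ℝ
  νm : ℝ
  ρp : ℝ
  ρm : ℝ
  cp : ℝ
  cm : ℝ
  Δzp : ℝ
  Δzm : ℝ
  Δt : ℝ
  b : ℝ
  νp_pos : 0 < νp
  νm_pos : 0 < νm
  ρp_pos : 0 < ρp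
  ρm_pos : 0 < ρm
  cp_pos : 0 < cp
  cm_pos : 0 < cm
  Δzp_pos : 0 < Δzp
  Δzm_pos : 0 < Δzm
  Δt_pos : 0 < Δt
  b_nonneg : 0 ≤ b

namespace CouplingParams

variable (P : CouplingParams)

/-- The diffusion number `d₊ = ν₊ Δt / (ρ₊ c₊ Δz₊²)`. -/
def dp : ℝ := P.νp * P.Δt / (P.ρp * P.cp * P.Δzp ^ 2)

/-- The diffusion number `d₋ = ν₋ Δt / (ρ₋ c₋ Δz₋²)`. -/
def dm : ℝ := P.νm * P.Δt / (P.ρm * P.cm * P.Δzm ^ 2)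

/-- The bulk Courant number `β₊ = b Δt / (ρ₊ c₊ Δz₊)`. -/
def βp : ℝ := P.b * P.Δt / (P.ρp * P.cp * P.Δzp)

/-- The bulk Courant number `β₋ = b Δt / (ρ₋ c₋ Δz₋)`. -/
def βm : ℝ := P.b * P.Δt / (P.ρm * P.cm * P.Δzm)

/-- The new-time flux `q_j` seen by the atmosphere at the cell edge `j ≥ 0`. A grid function
`T : ℤ → ℂ` stores the temperature of the cell centred at `z_{j+1/2}` as `T j`, so `T 0` and `T (-1)`
are the values next to the interface. At the interface edge `j = 0` the flux is the bulk flux, with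
the atmosphere's own new value and the lagged ocean value. -/
def fluxp (old new : ℤ → ℂ) (j : ℤ) : ℂ :=
  if j = 0 then P.b * (new 0 - old (-1)) else P.νp * ((new j - new (j - 1)) / P.Δzp)

/-- The new-time flux `q_j` seen by the ocean at the cell edge `j ≤ 0`; at the interface edge
`j = 0` it is the bulk flux with the lagged atmosphere value and the ocean's own new value. -/
def fluxm (old new : ℤ → ℂ) (j : ℤ) : ℂ :=
  if j = 0 then P.b * (old 0 - new (-1)) else P.νm * ((new j - new (j - 1)) / P.Δzm)

/-- One backward Euler step of the finite volume scheme with partially implicit flux coupling. -/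
def IsStep (old new : ℤ → ℂ) : Prop :=
  (∀ j : ℤ, 0 ≤ j → new j - old j =
    P.Δt / (P.ρp * P.cp * P.Δzp) * (P.fluxp old new (j + 1) - P.fluxp old new j)) ∧
  (∀ j : ℤ, j < 0 → new j - old j =
    P.Δt / (P.ρm * P.cm * P.Δzm) * (P.fluxm old new (j + 1) - P.fluxm old new j))

/-- `T n j` is the temperature at time level `n` in the cell centred at `z_{j+1/2}`. -/
def IsSolution (T : ℕ → ℤ → ℂ) : Prop := ∀ n, P.IsStep (T n) (T (n + 1))

/-- A nontrivial eigensolution `T^n_{j+1/2} = A ^ n φ_j` of the coupled scheme which satisfies the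
far-field boundary condition `φ_j → 0` as `j → ± ∞`. -/
def IsEigensolution (A : ℂ) (φ : ℤ → ℂ) : Prop :=
  φ ≠ 0 ∧ Tendsto φ atTop (𝓝 0) ∧ Tendsto φ atBot (𝓝 0) ∧ P.IsSolution fun n j => A ^ n * φ j

/-- Stability in `ℓ^p` with constant `C`: every solution of the scheme whose time levels lie in
`ℓ^p(ℤ)` satisfies `‖T^n‖ ≤ C ‖T^0‖` for all `n`. -/
def IsStable (p : ℝ≥0∞) (C : ℝ) : Prop :=
  ∀ T : ℕ → lp (fun _ : ℤ => ℂ) p, P.IsSolution (fun n j => T n j) → ∀ n, ‖T n‖ ≤ C * ‖T 0‖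

end CouplingParams

/-- The spatial profile `ap κp^(j+1)` for `j ≥ 0` and `am κm^j` for `j < 0`. -/
def modeProfile (am ap κm κp : ℂ) (j : ℤ) : ℂ :=
  if 0 ≤ j then ap * κp ^ (j + 1) else am * κm ^ j

end

open Filter Topology ComplexConjugate
open scoped ENNReal

/-- One backward Euler step for the heat equation on a half line with cells `0, 1, 2, …`,
diffusion number `d`, and a bulk flux with Courant number `β` between the new value in the
boundary cell and a given value `z`. -/
structure IsHalfStep (d β : ℝ) (old new : ℕ → ℂ) (z : ℂ) : Prop where
  boundary : new 0 - old 0 = d * (new 1 - new 0) - β * (new 0 - z)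
  interior : ∀ k, new (k + 1) - old (k + 1) = d * (new (k + 2) - 2 * new (k + 1) + new k)

namespace IsHalfStep

variable {d β : ℝ} {old new : ℕ → ℂ} {z : ℂ}

theorem norm_new_zero_le (h : IsHalfStep d β old new z) (hd : 0 ≤ d) (hβ : 0 ≤ β) :
    (1 + d + β) * ‖new 0‖ ≤ ‖old 0‖ + d * ‖new 1‖ + β * ‖z‖ := by
  have e : ((1 + d + β : ℝ) : ℂ) * new 0 = old 0 + d * new 1 + β * z := by
    push_cast
    linear_combination h.boundary
  have e' := congrArg norm e
  rw [norm_mul, Complex.norm_of_nonneg (by positivity)] at e'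
  rw [e']
  refine (norm_add₃_le).trans_eq ?_
  simp [abs_of_nonneg hd, abs_of_nonneg hβ]

theorem norm_new_succ_le (h : IsHalfStep d β old new z) (hd : 0 ≤ d) (k : ℕ) :
    (1 + 2 * d) * ‖new (k + 1)‖ ≤ ‖old (k + 1)‖ + d * ‖new (k + 2)‖ + d * ‖new k‖ := by
  have e : ((1 + 2 * d : ℝ) : ℂ) * new (k + 1) = old (k + 1) + d * new (k + 2) + d * new k := by
    push_cast
    linear_combination h.interior k
  have e' := congrArg norm e
  rw [norm_mul, Complex.norm_of_nonneg (by positivity)] at e'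
  rw [e']
  refine (norm_add₃_le).trans_eq ?_
  simp [abs_of_nonneg hd]

/-- Quantitative maximum principle on the half line. -/
theorem norm_new_le (h : IsHalfStep d β old new z) (hd : 0 ≤ d) (hβ : 0 ≤ β) {V M r : ℝ}
    (hr : 2 * d ≤ r * (1 + 2 * d))
    (hV : ∀ k, ‖old k‖ ≤ V) (hz : ‖z‖ ≤ V) (hM : ∀ k, ‖new k‖ ≤ M) (hVM : V ≤ M) (k : ℕ) :
    ‖new k‖ ≤ (1 - r) * V + r * M := by
  rcases k with _ | k
  · have h0 := h.norm_new_zero_le hd hβ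
    have h1 := mul_le_mul_of_nonneg_left (hM 1) hd
    have h2 := mul_le_mul_of_nonneg_left hz hβ
    have hr' : d ≤ r * (1 + d + β) := by nlinarith
    refine le_of_mul_le_mul_left ?_ (show 0 < 1 + d + β by positivity)
    nlinarith [hV 0, mul_nonneg (sub_nonneg.2 hr') (sub_nonneg.2 hVM)]
  · have h0 := h.norm_new_succ_le hd k
    have h1 := mul_le_mul_of_nonneg_left (hM k) hd
    have h2 := mul_le_mul_of_nonneg_left (hM (k + 2)) hd
    refine le_of_mul_le_mul_left ?_ (show 0 < 1 + 2 * d by positivity)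
    nlinarith [hV (k + 1), mul_nonneg (sub_nonneg.2 hr) (sub_nonneg.2 hVM)]

/-- A geometric-in-time half-line solution with amplification factor outside the open unit disc and
different from `1` is strictly smaller than its bound. -/
theorem norm_le_of_amplification {A : ℂ} {φ : ℕ → ℂ} {ζ : ℂ}
    (h : IsHalfStep d β φ (fun k => A * φ k) ζ) (hd : 0 ≤ d) (hβ : 0 ≤ β) (hA : 1 ≤ ‖A‖)
    {M r : ℝ} (hr : 2 * d ≤ r * (1 - A⁻¹.re + 2 * d))
    (hr' : d + β ≤ r * (1 - A⁻¹.re + d + β)) (hδ : 0 < 1 - A⁻¹.re)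
    (hM : ∀ k, ‖φ k‖ ≤ M) (hζ : ‖ζ‖ ≤ M) (k : ℕ) : ‖φ k‖ ≤ r * M := by
  have hA0 : A ≠ 0 := norm_pos_iff.1 (by linarith)
  have hM0 : 0 ≤ M := (norm_nonneg _).trans hζ
  have hAinv : ‖A⁻¹‖ ≤ 1 := by rw [norm_inv]; exact inv_le_one_of_one_le₀ hA
  rcases k with _ | k
  · have e : ((1 + d + β : ℝ) - A⁻¹ : ℂ) * φ 0 = d * φ 1 + β * (A⁻¹ * ζ) := by
      have := h.boundary
      push_cast
      field_simp
      linear_combination this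
    have e1 : (1 - A⁻¹.re + d + β) * ‖φ 0‖ ≤ (d + β) * M := by
      calc (1 - A⁻¹.re + d + β) * ‖φ 0‖ ≤ ‖((1 + d + β : ℝ) - A⁻¹ : ℂ)‖ * ‖φ 0‖ := by
            gcongr
            refine le_trans (le_of_eq ?_) (Complex.re_le_norm _)
            rw [Complex.sub_re, Complex.ofReal_re]; ring
        _ = ‖d * φ 1 + β * (A⁻¹ * ζ)‖ := by rw [← norm_mul, e]
        _ ≤ d * ‖φ 1‖ + β * (‖A⁻¹‖ * ‖ζ‖) := by
            refine (norm_add_le _ _).trans_eq ?_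
            simp [abs_of_nonneg hd, abs_of_nonneg hβ]
        _ ≤ d * M + β * (1 * M) := by gcongr; exact hM 1
        _ = _ := by ring
    refine le_of_mul_le_mul_left ?_ (show 0 < 1 - A⁻¹.re + d + β by linarith)
    nlinarith [mul_le_mul_of_nonneg_right hr' hM0]
  · have e : ((1 + 2 * d : ℝ) - A⁻¹ : ℂ) * φ (k + 1) = d * φ (k + 2) + d * φ k := by
      have := h.interior k
      push_cast
      field_simp
      linear_combination this
    have e1 : (1 - A⁻¹.re + 2 * d) * ‖φ (k + 1)‖ ≤ 2 * d * M := by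
      calc (1 - A⁻¹.re + 2 * d) * ‖φ (k + 1)‖ ≤ ‖((1 + 2 * d : ℝ) - A⁻¹ : ℂ)‖ * ‖φ (k + 1)‖ := by
            gcongr
            refine le_trans (le_of_eq ?_) (Complex.re_le_norm _)
            rw [Complex.sub_re, Complex.ofReal_re]; ring
        _ = ‖d * φ (k + 2) + d * φ k‖ := by rw [← norm_mul, e]
        _ ≤ d * ‖φ (k + 2)‖ + d * ‖φ k‖ := by
            refine (norm_add_le _ _).trans_eq ?_
            simp [abs_of_nonneg hd]
        _ ≤ d * M + d * M := by gcongr <;> exact hM _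
        _ = _ := by ring
    refine le_of_mul_le_mul_left ?_ (show 0 < 1 - A⁻¹.re + 2 * d by linarith)
    nlinarith [mul_le_mul_of_nonneg_right hr hM0]

/-- A bounded steady state on the half line is constant. -/
theorem eq_of_steady {φ : ℕ → ℂ} {ζ : ℂ} (h : IsHalfStep d β φ φ ζ) (hd : 0 < d) {K : ℝ}
    (hK : ∀ k, ‖φ k‖ ≤ K) (k : ℕ) : φ k = φ 0 := by
  have hdiff : ∀ k, φ (k + 1) - φ k = φ 1 - φ 0 := by
    intro k
    induction k with
    | zero => rfl
    | succ k ih =>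
      have h1 := h.interior k
      rw [sub_self, eq_comm, mul_eq_zero, or_iff_right (by exact_mod_cast hd.ne')] at h1
      linear_combination h1 + ih
  have hlin : ∀ k : ℕ, φ k = φ 0 + k * (φ 1 - φ 0) := by
    intro k
    induction k with
    | zero => simp
    | succ k ih => push_cast; linear_combination ih + hdiff k
  have hs : φ 1 - φ 0 = 0 := by
    by_contra hne
    obtain ⟨n, hn⟩ := exists_nat_gt (2 * K / ‖φ 1 - φ 0‖)
    rw [div_lt_iff₀ (norm_pos_iff.2 hne)] at hn
    have e : (n : ℂ) * (φ 1 - φ 0) = φ n - φ 0 := by rw [hlin n]; ring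
    have e' := congrArg norm e
    rw [norm_mul, Complex.norm_natCast] at e'
    linarith [norm_sub_le (φ n) (φ 0), hK n, hK 0]
  rw [hlin k, hs]; simp

theorem eq_of_steady_boundary {φ : ℕ → ℂ} {ζ : ℂ} (h : IsHalfStep d β φ φ ζ) (h1 : φ 1 = φ 0)
    (hβ : β ≠ 0) : φ 0 = ζ := by
  have := h.boundary
  rw [h1] at this
  have h2 : (β : ℂ) * (φ 0 - ζ) = 0 := by linear_combination this
  rw [mul_eq_zero, or_iff_right (by exact_mod_cast hβ)] at h2
  exact sub_eq_zero.1 h2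

theorem two_mul_re_conj_mul_le (a b : ℂ) : 2 * (conj a * b).re ≤ ‖a‖ ^ 2 + ‖b‖ ^ 2 := by
  rw [← Complex.normSq_eq_norm_sq, ← Complex.normSq_eq_norm_sq, Complex.normSq_apply,
    Complex.normSq_apply, Complex.mul_re, Complex.conj_re, Complex.conj_im]
  nlinarith [sq_nonneg (a.re - b.re), sq_nonneg (a.im - b.im)]

theorem re_conj_mul_self (a : ℂ) : (conj a * a).re = ‖a‖ ^ 2 := by
  rw [← Complex.normSq_eq_norm_sq, Complex.normSq_apply, Complex.mul_re, Complex.conj_re,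
    Complex.conj_im]
  ring

/-- The discrete energy estimate on the half line. -/
theorem tsum_norm_sq_le (h : IsHalfStep d β old new z) (hd : 0 ≤ d) (hβ : 0 ≤ β)
    (ho : Summable fun k => ‖old k‖ ^ 2) (hn : Summable fun k => ‖new k‖ ^ 2) :
    ∑' k, ‖new k‖ ^ 2 + β * ‖new 0‖ ^ 2 ≤ ∑' k, ‖old k‖ ^ 2 + β * ‖z‖ ^ 2 := by
  have hb : ‖new 0‖ ^ 2 - ‖old 0‖ ^ 2 ≤
      d * (‖new 1‖ ^ 2 - ‖new 0‖ ^ 2) - β * (‖new 0‖ ^ 2 - ‖z‖ ^ 2) := by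
    have e : ((1 + d + β : ℝ) : ℂ) * (conj (new 0) * new 0) =
        conj (new 0) * old 0 + (d : ℝ) * (conj (new 0) * new 1)
          + (β : ℝ) * (conj (new 0) * z) := by
      push_cast
      linear_combination conj (new 0) * h.boundary
    have e' := congrArg Complex.re e
    simp only [Complex.add_re, Complex.re_ofReal_mul, re_conj_mul_self] at e'
    have h1 := two_mul_re_conj_mul_le (new 0) (old 0)
    have h2 := mul_le_mul_of_nonneg_left (two_mul_re_conj_mul_le (new 0) (new 1)) hd
    have h3 := mul_le_mul_of_nonneg_left (two_mul_re_conj_mul_le (new 0) z) hβ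
    linarith
  have hi : ∀ k, ‖new (k + 1)‖ ^ 2 - ‖old (k + 1)‖ ^ 2 ≤
      d * (‖new (k + 2)‖ ^ 2 - 2 * ‖new (k + 1)‖ ^ 2 + ‖new k‖ ^ 2) := by
    intro k
    have e : ((1 + 2 * d : ℝ) : ℂ) * (conj (new (k + 1)) * new (k + 1)) =
        conj (new (k + 1)) * old (k + 1) + (d : ℝ) * (conj (new (k + 1)) * new (k + 2))
          + (d : ℝ) * (conj (new (k + 1)) * new k) := by
      push_cast
      linear_combination conj (new (k + 1)) * h.interior k
    have e' := congrArg Complex.re e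
    simp only [Complex.add_re, Complex.re_ofReal_mul, re_conj_mul_self] at e'
    have h1 := two_mul_re_conj_mul_le (new (k + 1)) (old (k + 1))
    have h2 := mul_le_mul_of_nonneg_left (two_mul_re_conj_mul_le (new (k + 1)) (new (k + 2))) hd
    have h3 := mul_le_mul_of_nonneg_left (two_mul_re_conj_mul_le (new (k + 1)) (new k)) hd
    linarith
  have hn1 := (summable_nat_add_iff 1).2 hn
  have hn2 := (summable_nat_add_iff 2).2 hn
  have ho1 := (summable_nat_add_iff 1).2 ho
  have hs := hasSum_le hi (hn1.hasSum.sub ho1.hasSum)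
    (((hn2.hasSum.sub (hn1.hasSum.mul_left 2)).add hn.hasSum).mul_left d)
  have t1 := hn.sum_add_tsum_nat_add 1
  have t2 := hn.sum_add_tsum_nat_add 2
  have t3 := ho.sum_add_tsum_nat_add 1
  simp only [Finset.sum_range_succ, Finset.sum_range_zero, zero_add] at t1 t2 t3
  rw [← eq_sub_iff_add_eq'] at t1 t2 t3
  rw [t1, t2, t3] at hs
  linarith

end IsHalfStep

namespace CouplingParams

variable (P : CouplingParams)

theorem dp_pos : 0 < P.dp := by
  have := P.νp_pos; have := P.ρp_pos; have := P.cp_pos; have := P.Δzp_pos; have := P.Δt_pos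
  unfold dp; positivity

theorem dm_pos : 0 < P.dm := by
  have := P.νm_pos; have := P.ρm_pos; have := P.cm_pos; have := P.Δzm_pos; have := P.Δt_pos
  unfold dm; positivity

theorem βp_nonneg : 0 ≤ P.βp := by
  have := P.b_nonneg; have := P.ρp_pos; have := P.cp_pos; have := P.Δzp_pos; have := P.Δt_pos
  unfold βp; positivity

theorem βm_nonneg : 0 ≤ P.βm := by
  have := P.b_nonneg; have := P.ρm_pos; have := P.cm_pos; have := P.Δzm_pos; have := P.Δt_pos
  unfold βm; positivity

theorem βp_pos (hb : 0 < P.b) : 0 < P.βp := by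
  have := P.ρp_pos; have := P.cp_pos; have := P.Δzp_pos; have := P.Δt_pos
  unfold βp; positivity

variable {P}

/-- The atmosphere part of a coupled step. -/
theorem IsStep.atmosphere {old new : ℤ → ℂ} (h : P.IsStep old new) :
    IsHalfStep P.dp P.βp (fun k => old k) (fun k => new k) (old (-1)) := by
  have h1 : (P.ρp : ℂ) ≠ 0 := by exact_mod_cast P.ρp_pos.ne'
  have h2 : (P.cp : ℂ) ≠ 0 := by exact_mod_cast P.cp_pos.ne'
  have h3 : (P.Δzp : ℂ) ≠ 0 := by exact_mod_cast P.Δzp_pos.ne'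
  constructor
  · have e := h.1 0 le_rfl
    simp only [fluxp, zero_add, one_ne_zero, if_true, if_false, sub_self] at e
    simp only [Nat.cast_zero, Nat.cast_one]
    rw [e, dp, βp]
    push_cast
    field_simp
  · intro k
    have e := h.1 (k + 1) (by positivity)
    rw [fluxp, fluxp, if_neg (by positivity), if_neg (by positivity), add_sub_cancel_right,
      add_sub_cancel_right, add_assoc, one_add_one_eq_two] at e
    push_cast
    rw [e, dp]
    push_cast
    field_simp
    ring

/-- The ocean part of a coupled step, with the cells numbered from the interface downwards. -/
theorem IsStep.ocean {old new : ℤ → ℂ} (h : P.IsStep old new) :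
    IsHalfStep P.dm P.βm (fun k => old (-(k + 1))) (fun k => new (-(k + 1))) (old 0) := by
  have h1 : (P.ρm : ℂ) ≠ 0 := by exact_mod_cast P.ρm_pos.ne'
  have h2 : (P.cm : ℂ) ≠ 0 := by exact_mod_cast P.cm_pos.ne'
  have h3 : (P.Δzm : ℂ) ≠ 0 := by exact_mod_cast P.Δzm_pos.ne'
  constructor
  · have e := h.2 (-1) (by norm_num)
    norm_num [fluxm] at e
    norm_num
    rw [e, dm, βm]
    push_cast
    field_simp
    ring
  · intro k
    have e := h.2 (-(k + 2)) (by linarith [k.cast_nonneg (α := ℤ)])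
    rw [fluxm, fluxm, if_neg (by omega), if_neg (by omega),
      show -((k : ℤ) + 2) + 1 = -(k + 1) by ring, show -((k : ℤ) + 1) - 1 = -(k + 2) by ring,
      show -((k : ℤ) + 2) - 1 = -(k + 3) by ring] at e
    push_cast
    rw [show -((k : ℤ) + 1 + 1) = -(k + 2) by ring, show -((k : ℤ) + 2 + 1) = -(k + 3) by ring,
      e, dm]
    push_cast
    field_simp
    ring

theorem forall_int_of_half_lines {p : ℤ → Prop} (h1 : ∀ k : ℕ, p k) (h2 : ∀ k : ℕ, p (-(k + 1)))
    (j : ℤ) : p j := by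
  rcases j with k | k
  · exact h1 k
  · rw [Int.negSucc_eq]; exact h2 k

theorem IsSolution.step_zero {A : ℂ} {φ : ℤ → ℂ} (h : P.IsSolution fun n j => A ^ n * φ j) :
    P.IsStep φ (fun j => A * φ j) := by
  simpa using h 0

/-- The maximum principle for one coupled step between bounded grid functions. -/
theorem IsStep.norm_le {old new : lp (fun _ : ℤ => ℂ) ∞} (h : P.IsStep old new) :
    ‖new‖ ≤ ‖old‖ := by
  by_contra! hlt
  set D := max P.dp P.dm
  have hD : 0 < D := lt_max_of_lt_left P.dp_pos
  set r := 2 * D / (1 + 2 * D) with hr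
  have hr1 : r < 1 := by rw [hr, div_lt_one (by positivity)]; linarith
  have key : ∀ d ≤ D, 0 ≤ d → 2 * d ≤ r * (1 + 2 * d) := by
    intro d hd hd0
    rw [hr, div_mul_eq_mul_div, le_div_iff₀ (by positivity)]
    nlinarith
  have ho := lp.norm_apply_le_norm ENNReal.top_ne_zero old
  have hn := lp.norm_apply_le_norm ENNReal.top_ne_zero new
  have hj : ∀ j, ‖new j‖ ≤ (1 - r) * ‖old‖ + r * ‖new‖ := forall_int_of_half_lines
    (h.atmosphere.norm_new_le P.dp_pos.le P.βp_nonneg (key _ (le_max_left _ _) P.dp_pos.le)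
      (fun _ => ho _) (ho _) (fun _ => hn _) hlt.le)
    (h.ocean.norm_new_le P.dm_pos.le P.βm_nonneg (key _ (le_max_right _ _) P.dm_pos.le)
      (fun _ => ho _) (ho _) (fun _ => hn _) hlt.le)
  have := lp.norm_le_of_forall_le' _ hj
  nlinarith

variable (P)

theorem isStable_top : P.IsStable ∞ 1 := by
  intro T hT n
  rw [one_mul]
  induction n with
  | zero => exact le_rfl
  | succ n ih => exact (hT n).norm_le.trans ih

/-- Heat capacity of an atmosphere cell. -/
def cellCapacityp : ℝ := P.ρp * P.cp * P.Δzp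

/-- Heat capacity of an ocean cell. -/
def cellCapacitym : ℝ := P.ρm * P.cm * P.Δzm

theorem cellCapacityp_pos : 0 < P.cellCapacityp :=
  mul_pos (mul_pos P.ρp_pos P.cp_pos) P.Δzp_pos

theorem cellCapacitym_pos : 0 < P.cellCapacitym :=
  mul_pos (mul_pos P.ρm_pos P.cm_pos) P.Δzm_pos

theorem cellCapacityp_mul_βp : P.cellCapacityp * P.βp = P.b * P.Δt :=
  mul_div_cancel₀ _ P.cellCapacityp_pos.ne'

theorem cellCapacitym_mul_βm : P.cellCapacitym * P.βm = P.b * P.Δt :=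
  mul_div_cancel₀ _ P.cellCapacitym_pos.ne'

/-- The discrete energy: heat-capacity weighted squares plus an interface term that accounts for
the lagged interface values. -/
noncomputable def energy (u : ℤ → ℂ) : ℝ :=
  P.cellCapacityp * ∑' k : ℕ, ‖u k‖ ^ 2 + P.cellCapacitym * ∑' k : ℕ, ‖u (-(k + 1))‖ ^ 2 +
    P.b * P.Δt * (‖u 0‖ ^ 2 + ‖u (-1)‖ ^ 2)

theorem summable_norm_sq (u : lp (fun _ : ℤ => ℂ) 2) : Summable fun j => ‖u j‖ ^ 2 := by
  have := (lp.memℓp u).summable (by norm_num)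
  simpa using this

theorem norm_sq_eq_tsum (u : lp (fun _ : ℤ => ℂ) 2) : ‖u‖ ^ 2 = ∑' j, ‖u j‖ ^ 2 := by
  have := lp.norm_rpow_eq_tsum (p := 2) (by norm_num) u
  simpa using this

theorem summable_norm_sq_atmosphere (u : lp (fun _ : ℤ => ℂ) 2) :
    Summable fun k : ℕ => ‖u k‖ ^ 2 :=
  (summable_norm_sq u).comp_injective (i := fun k : ℕ => (k : ℤ)) Nat.cast_injective

theorem summable_norm_sq_ocean (u : lp (fun _ : ℤ => ℂ) 2) :
    Summable fun k : ℕ => ‖u (-(k + 1))‖ ^ 2 :=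
  (summable_norm_sq u).comp_injective (i := fun k : ℕ => -((k : ℤ) + 1)) fun a b h => by
    simpa using h

theorem norm_sq_eq_add (u : lp (fun _ : ℤ => ℂ) 2) :
    ‖u‖ ^ 2 = ∑' k : ℕ, ‖u k‖ ^ 2 + ∑' k : ℕ, ‖u (-(k + 1))‖ ^ 2 := by
  rw [norm_sq_eq_tsum]
  exact tsum_of_nat_of_neg_add_one (f := fun j => ‖u j‖ ^ 2) (summable_norm_sq_atmosphere u)
    (summable_norm_sq_ocean u)

variable {P} in
theorem IsStep.energy_le {old new : lp (fun _ : ℤ => ℂ) 2} (h : P.IsStep old new) :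
    P.energy new ≤ P.energy old := by
  have hp := mul_le_mul_of_nonneg_left (h.atmosphere.tsum_norm_sq_le P.dp_pos.le P.βp_nonneg
    (summable_norm_sq_atmosphere old) (summable_norm_sq_atmosphere new)) P.cellCapacityp_pos.le
  have hm := mul_le_mul_of_nonneg_left (h.ocean.tsum_norm_sq_le P.dm_pos.le P.βm_nonneg
    (summable_norm_sq_ocean old) (summable_norm_sq_ocean new)) P.cellCapacitym_pos.le
  simp only [mul_add, ← mul_assoc, cellCapacityp_mul_βp, cellCapacitym_mul_βm, Nat.cast_zero,
    zero_add] at hp hm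
  unfold energy
  simp only [neg_add_rev] at hp hm ⊢
  linarith

theorem min_mul_norm_sq_le_energy (u : lp (fun _ : ℤ => ℂ) 2) :
    min P.cellCapacityp P.cellCapacitym * ‖u‖ ^ 2 ≤ P.energy u := by
  rw [norm_sq_eq_add, energy, mul_add]
  have h0 : 0 ≤ P.b * P.Δt := mul_nonneg P.b_nonneg P.Δt_pos.le
  have h1 : 0 ≤ ∑' k : ℕ, ‖u k‖ ^ 2 := tsum_nonneg fun _ => by positivity
  have h2 : 0 ≤ ∑' k : ℕ, ‖u (-(k + 1))‖ ^ 2 := tsum_nonneg fun _ => by positivity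
  have h3 := mul_le_mul_of_nonneg_right (min_le_left P.cellCapacityp P.cellCapacitym) h1
  have h4 := mul_le_mul_of_nonneg_right (min_le_right P.cellCapacityp P.cellCapacitym) h2
  have h5 : 0 ≤ P.b * P.Δt * (‖u 0‖ ^ 2 + ‖u (-1)‖ ^ 2) := by positivity
  linarith

theorem energy_le_mul_norm_sq (u : lp (fun _ : ℤ => ℂ) 2) :
    P.energy u ≤ (P.cellCapacityp + P.cellCapacitym + P.b * P.Δt) * ‖u‖ ^ 2 := by
  rw [norm_sq_eq_add, energy]
  have h0 : 0 ≤ P.b * P.Δt := mul_nonneg P.b_nonneg P.Δt_pos.le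
  have h1 : 0 ≤ ∑' k : ℕ, ‖u k‖ ^ 2 := tsum_nonneg fun _ => by positivity
  have h2 : 0 ≤ ∑' k : ℕ, ‖u (-(k + 1))‖ ^ 2 := tsum_nonneg fun _ => by positivity
  have h3 := (summable_norm_sq_atmosphere u).le_tsum 0 fun _ _ => by positivity
  have h4 := (summable_norm_sq_ocean u).le_tsum 0 fun _ _ => by positivity
  simp only [Nat.cast_zero, zero_add] at h3 h4
  have h5 := mul_le_mul_of_nonneg_left (add_le_add h3 h4) h0
  have h6 := mul_nonneg P.cellCapacityp_pos.le h2
  have h7 := mul_nonneg P.cellCapacitym_pos.le h1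
  linarith

theorem exists_isStable_two : ∃ C : ℝ, P.IsStable 2 C := by
  set w := min P.cellCapacityp P.cellCapacitym
  set W := P.cellCapacityp + P.cellCapacitym + P.b * P.Δt
  have hw : 0 < w := lt_min P.cellCapacityp_pos P.cellCapacitym_pos
  have hW : 0 ≤ W := add_nonneg (add_pos P.cellCapacityp_pos P.cellCapacitym_pos).le
    (mul_nonneg P.b_nonneg P.Δt_pos.le)
  refine ⟨√(W / w), fun T hT n => ?_⟩
  have hE : P.energy (T n) ≤ P.energy (T 0) := by
    induction n with
    | zero => exact le_rfl
    | succ n ih => exact (IsStep.energy_le (hT n)).trans ih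
  refine (sq_le_sq₀ (norm_nonneg _) (by positivity)).1 ?_
  rw [mul_pow, Real.sq_sqrt (by positivity), div_mul_eq_mul_div, le_div_iff₀ hw, mul_comm]
  exact ((P.min_mul_norm_sq_le_energy _).trans hE).trans (P.energy_le_mul_norm_sq _)

variable {P}

/-- A nonzero bounded mode with amplification factor outside the open unit disc has amplification
factor `1`. -/
theorem IsStep.amplification_eq_one {A : ℂ} {φ : ℤ → ℂ} (h : P.IsStep φ fun j => A * φ j)
    (hφ : φ ≠ 0) {K : ℝ} (hK : ∀ j, ‖φ j‖ ≤ K) (hA : 1 ≤ ‖A‖) : A = 1 := by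
  by_contra hA1
  have hAinv : ‖A⁻¹‖ ≤ 1 := by rw [norm_inv]; exact inv_le_one_of_one_le₀ hA
  have hδ : 0 < 1 - A⁻¹.re := by
    rw [sub_pos]
    refine lt_of_le_of_ne ((Complex.re_le_norm _).trans hAinv) fun hre => hA1 ?_
    have him : A⁻¹.im = 0 := by
      have h1 := Complex.sq_norm A⁻¹
      rw [Complex.normSq_apply, hre] at h1
      nlinarith [norm_nonneg A⁻¹]
    exact inv_eq_one.1 (Complex.ext hre him)
  set δ := 1 - A⁻¹.re with hδ_def
  set D := P.dp + P.dm + P.dp + P.dm + P.βp + P.βm with hD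
  have := P.dp_pos; have := P.dm_pos; have := P.βp_nonneg; have := P.βm_nonneg
  have hD0 : 0 < D := by positivity
  set r := D / (δ + D) with hr
  have hr0 : 0 ≤ r := by positivity
  have hr1 : r < 1 := by rw [hr, div_lt_one (by positivity)]; linarith
  have key : ∀ x ≤ D, x ≤ r * (δ + x) := by
    intro x hx
    rw [hr, div_mul_eq_mul_div, le_div_iff₀ (by positivity)]
    nlinarith
  have hbdd : BddAbove (Set.range fun j => ‖φ j‖) := ⟨K, by rintro _ ⟨j, rfl⟩; exact hK j⟩
  set M := ⨆ j, ‖φ j‖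
  have hM : ∀ j, ‖φ j‖ ≤ M := le_ciSup hbdd
  have hj : ∀ j, ‖φ j‖ ≤ r * M := forall_int_of_half_lines
    (h.atmosphere.norm_le_of_amplification P.dp_pos.le P.βp_nonneg hA (key _ (by linarith))
      (by rw [add_assoc]; exact key _ (by linarith)) hδ (fun _ => hM _) (hM _))
    (h.ocean.norm_le_of_amplification P.dm_pos.le P.βm_nonneg hA (key _ (by linarith))
      (by rw [add_assoc]; exact key _ (by linarith)) hδ (fun _ => hM _) (hM _))
  have hMr : M ≤ r * M := ciSup_le hj
  have hM0 : M ≤ 0 := by nlinarith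
  exact hφ (funext fun j => norm_le_zero_iff.1 ((hM j).trans hM0))

/-- Bounded steady states of the coupled scheme carry no flux. -/
theorem IsStep.steady_eq {φ : ℤ → ℂ} (h : P.IsStep φ φ) {K : ℝ} (hK : ∀ j, ‖φ j‖ ≤ K) :
    (∀ j, 0 ≤ j → φ j = φ 0) ∧ (∀ j, j < 0 → φ j = φ (-1)) ∧ (0 < P.b → φ 0 = φ (-1)) := by
  have hp := h.atmosphere.eq_of_steady P.dp_pos (fun _ => hK _)
  have hm := h.ocean.eq_of_steady P.dm_pos (fun _ => hK _)
  refine ⟨fun j hj => ?_, fun j hj => ?_, fun hb => ?_⟩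
  · lift j to ℕ using hj
    simpa using hp j
  · obtain ⟨k, rfl⟩ : ∃ k : ℕ, j = -(k + 1) := ⟨(-j - 1).toNat, by omega⟩
    simpa using hm k
  · exact h.atmosphere.eq_of_steady_boundary (hp 1) (P.βp_pos hb).ne'

theorem steady_of_bounded {A : ℂ} {φ : ℤ → ℂ} (hφ : φ ≠ 0) (hK : ∃ K : ℝ, ∀ j, ‖φ j‖ ≤ K)
    (h : P.IsSolution fun n j => A ^ n * φ j) (hA : 1 ≤ ‖A‖) :
    A = 1 ∧ (∀ j, 0 ≤ j → φ j = φ 0) ∧ (∀ j, j < 0 → φ j = φ (-1)) ∧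
      (0 < P.b → φ 0 = φ (-1)) := by
  obtain ⟨K, hK⟩ := hK
  obtain rfl := h.step_zero.amplification_eq_one hφ hK hA
  exact ⟨rfl, IsStep.steady_eq (by simpa using h.step_zero) hK⟩

theorem exists_norm_le_of_tendsto {φ : ℤ → ℂ} (ht : Tendsto φ atTop (𝓝 0))
    (hb : Tendsto φ atBot (𝓝 0)) : ∃ K : ℝ, ∀ j, ‖φ j‖ ≤ K := by
  have h : Tendsto φ cofinite (𝓝 0) := by
    rw [Int.cofinite_eq]
    exact hb.sup ht
  have hfin : {j | ¬ ‖φ j‖ ≤ 1}.Finite := by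
    have := h.norm
    rw [norm_zero] at this
    exact this.eventually_le_const one_pos
  obtain ⟨K, hK⟩ := (hfin.image fun j => ‖φ j‖).bddAbove
  refine ⟨max K 1, fun j => ?_⟩
  by_cases hj : ‖φ j‖ ≤ 1
  · exact hj.trans (le_max_right _ _)
  · exact (hK ⟨j, hj, rfl⟩).trans (le_max_left _ _)

theorem IsEigensolution.norm_lt_one {A : ℂ} {φ : ℤ → ℂ} (h : P.IsEigensolution A φ) :
    ‖A‖ < 1 := by
  by_contra! hA
  obtain ⟨hφ, ht, hb, hs⟩ := h
  obtain ⟨-, hp, hm, -⟩ := steady_of_bounded hφ (exists_norm_le_of_tendsto ht hb) hs hA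
  have h0 : φ 0 = 0 := tendsto_nhds_unique
    (tendsto_const_nhds.congr' ((eventually_ge_atTop 0).mono fun j hj => (hp j hj).symm)) ht
  have h1 : φ (-1) = 0 := tendsto_nhds_unique
    (tendsto_const_nhds.congr' ((eventually_lt_atBot 0).mono fun j hj => (hm j hj).symm)) hb
  refine hφ (funext fun j => ?_)
  rcases le_or_gt 0 j with hj | hj
  · rw [hp j hj, h0]; rfl
  · rw [hm j hj, h1]; rfl

theorem one_add_lt_norm_denominator {d : ℝ} (hd : 0 < d) (β : ℝ) {κ : ℂ} (hκ : ‖κ‖ < 1) :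
    1 + β < ‖(β + 1 - d * (κ - 1) : ℂ)‖ := by
  refine lt_of_lt_of_le ?_ (Complex.re_le_norm _)
  have e : (β + 1 - d * (κ - 1) : ℂ).re = β + 1 - d * (κ.re - 1) := by simp
  rw [e]
  nlinarith [Complex.re_le_norm κ]

theorem norm_one_add_mul_le {β : ℝ} (hβ : 0 ≤ β) {θ : ℂ} (hθ : ‖θ‖ ≤ 1) :
    ‖1 + β * θ‖ ≤ 1 + β := by
  refine (norm_add_le _ _).trans ?_
  rw [norm_one, norm_mul, Complex.norm_of_nonneg hβ]
  nlinarith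

/-- The two interface equations for a geometric mode. -/
theorem amplification_of_modeProfile {A am ap κm κp : ℂ} (ham : am ≠ 0) (hap : ap ≠ 0)
    (hκp : κp ≠ 0) (hκm : κm ≠ 0)
    (h : P.IsSolution fun n j => A ^ n * modeProfile am ap κm κp j) :
    A * (P.βp + 1 - P.dp * (κp - 1)) = 1 + P.βp * (am / ap * κm⁻¹ * κp⁻¹) ∧
    A * (P.βm + 1 - P.dm * (κm⁻¹ - 1)) = 1 + P.βm * (ap / am * κm * κp) := by
  have e0 : modeProfile am ap κm κp 0 = ap * κp := by simp [modeProfile]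
  have e1 : modeProfile am ap κm κp 1 = ap * κp ^ 2 := by simp [modeProfile]
  have e2 : modeProfile am ap κm κp (-1) = am * κm⁻¹ := by simp [modeProfile]
  have e3 : modeProfile am ap κm κp (-2) = am * (κm⁻¹) ^ 2 := by
    simp [modeProfile, zpow_neg]
  have hp := h.step_zero.atmosphere.boundary
  have hm := h.step_zero.ocean.boundary
  norm_num [e0, e1, e2, e3] at hp hm
  constructor
  · field_simp at hp ⊢
    linear_combination hp
  · field_simp at hm ⊢
    linear_combination hm

end CouplingParams

theorem mainTheorem3 (P : CouplingParams) :
    -- there is no normal-mode eigensolution with modulus of the amplification factor at least one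
    (¬ ∃ (A : ℂ) (φ : ℤ → ℂ), 1 ≤ ‖A‖ ∧ P.IsEigensolution A φ) ∧
    -- if boundedness replaces decay, only the steady states without flux are left
    (∀ (A : ℂ) (φ : ℤ → ℂ), φ ≠ 0 → (∃ K : ℝ, ∀ j, ‖φ j‖ ≤ K) →
      P.IsSolution (fun n j => A ^ n * φ j) → 1 ≤ ‖A‖ →
        A = 1 ∧ (∀ j, 0 ≤ j → φ j = φ 0) ∧ (∀ j, j < 0 → φ j = φ (-1)) ∧
          (0 < P.b → φ 0 = φ (-1))) ∧
    -- formulas for the amplification factor of a geometric mode, with bounds on their parts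
    (∀ A am ap κm κp : ℂ, am ≠ 0 → ap ≠ 0 → κp ≠ 0 → ‖κp‖ < 1 → 1 < ‖κm‖ →
      P.IsSolution (fun n j => A ^ n * modeProfile am ap κm κp j) →
        A = (1 + P.βp * (am / ap * κm⁻¹ * κp⁻¹)) / (P.βp + 1 - P.dp * (κp - 1)) ∧
        A = (1 + P.βm * (ap / am * κm * κp)) / (P.βm + 1 - P.dm * (κm⁻¹ - 1)) ∧
        1 + P.βp < ‖(P.βp + 1 - P.dp * (κp - 1) : ℂ)‖ ∧
        1 + P.βm < ‖(P.βm + 1 - P.dm * (κm⁻¹ - 1) : ℂ)‖ ∧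
        (‖am / ap * κm⁻¹ * κp⁻¹‖ ≤ 1 → ‖1 + P.βp * (am / ap * κm⁻¹ * κp⁻¹)‖ ≤ 1 + P.βp) ∧
        (‖ap / am * κm * κp‖ ≤ 1 → ‖1 + P.βm * (ap / am * κm * κp)‖ ≤ 1 + P.βm)) ∧
    -- unconditional stability in the maximum norm and in the square-summable norm
    P.IsStable ∞ 1 ∧ ∃ C : ℝ, P.IsStable 2 C := by
  refine ⟨fun ⟨A, φ, hA, h⟩ => h.norm_lt_one.not_ge hA,
    fun A φ hφ hK h hA => CouplingParams.steady_of_bounded hφ hK h hA, ?_, P.isStable_top,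
    P.exists_isStable_two⟩
  intro A am ap κm κp ham hap hκp hκp1 hκm1 h
  have hκm : κm ≠ 0 := norm_pos_iff.1 (by linarith)
  obtain ⟨e1, e2⟩ := CouplingParams.amplification_of_modeProfile ham hap hκp hκm h
  have b1 := CouplingParams.one_add_lt_norm_denominator P.dp_pos P.βp hκp1
  have b2 := CouplingParams.one_add_lt_norm_denominator P.dm_pos P.βm
    (κ := κm⁻¹) (by rw [norm_inv]; exact inv_lt_one_of_one_lt₀ hκm1)
  have := P.βp_nonneg
  have := P.βm_nonneg
  exact ⟨(eq_div_iff (norm_pos_iff.1 (by linarith))).2 e1,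
    (eq_div_iff (norm_pos_iff.1 (by linarith))).2 e2, b1, b2,
    CouplingParams.norm_one_add_mul_le P.βp_nonneg,
    CouplingParams.norm_one_add_mul_le P.βm_nonneg⟩
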